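/- Let $\mathbb H$ be a complex Hilbert space with orthonormal basis $\{\phi_j\}_{j\in J}$ ($J$ an arbitrary index set), let $\mathbb H^{(n)}$ be the closed subspace of antisymmetric vectors of the Hilbert tensor power $\mathbb H^{\otimes n}$ (so $\mathbb H^{(0)}\cong\mathbb C$), and let $\mathbb F=\bigoplus_{n\ge 0}\mathbb H^{(n)}$ be the fermion Fock space, with number operator $N$. For a trace class operator $T$ on $\mathbb H^{(n)}$ and $m\le n$, let $T_{:m}$ denote its partial trace, the trace class operator on $\mathbb H^{(m)}$ given by $$\langle \xi,T_{:m}\psi\rangle=\sum_{\varphi}\langle \xi\otimes\varphi,\ \overline T(\psi\otimes\varphi)\rangle ,$$ where $\varphi$ runs over an orthonormal basis of $\mathbb H^{\otimes(n-m)}$ and $\overline T$ is the extension of $T$ by $0$ from $\mathbb H^{(n)}$ to $\mathbb H^{\otimes n}$. For a density operator $D=\bigoplus_n D_n$ on $\mathbb F$ that commutes with $N$ and satisfies $\sum_n n^m\operatorname{Tr}(D_n)<\infty$, the $m$-th order reduced number density operator is the operator on $\mathbb H^{(m)}$ $$\mathcal N_m(D)=\sum_{n\ge m}\frac{n!}{(n-m)!}\,D_{n:m}.$$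 Let $\mathbb P$ be a (discrete) probability measure on the set $\mathcal F$ of all finite subsets of $J$ such that the occupation numbers $N_j(\mathbf s)=1$ if $j\in\mathbf s$, $N_j(\mathbf s)=0$ if $j\notin\mathbf s$ ($j\in J$), are independent random variables under $\mathbb P$. For $\mathbf s=\{j_1,\dots,j_n\}\in\mathcal F$ let $P_{\mathbf s}$ be the orthogonal projector of $\mathbb F$ onto the span of the Slater determinant $$\Psi(\mathbf s)=\sqrt{n!}\,A_n(\phi_{j_1}\otimes\cdots\otimes\phi_{j_n}),\qquad A_n(x_1\otimes\cdots\otimes x_n)=\frac1{n!}\sum_{\pi}\operatorname{sgn}(\pi)\,x_{\pi^{-1}(1)}\otimes\cdots\otimes x_{\pi^{-1}(n)}$$ (for $\mathbf s=\emptyset$, the vacuum vector), and put $G=\sum_{\mathbf s\in\mathcal F}\mathbb P(\mathbf s)P_{\mathbf s}$. Then $G$ is a density operator on $\mathbb F$ that commutes with $N$ and satisfies $\sum_n n^m\operatorname{Tr}(G_n)<\infty$ for every integer $m\ge 0$ (so that all $\mathcal N_n(G)$ are defined), $\|\mathcal N_1(G)\|_1<\infty$, and for every integer $n\ge 0$ $$\|\mathcal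 N_n(G)\|_1\ \le\ \|\mathcal N_1(G)\|_1^{\,n},$$ where $\|T\|_1=\operatorname{Tr}|T|$ is the trace norm. -/

import Mathlib

noncomputable section

namespace Fermion

open scoped TensorProduct InnerProductSpace ENNReal Nat
open UniformSpace

/-! ## The Hilbert tensor power -/

section TensorPower

variable (H : Type*) [NormedAddCommGroup H] [InnerProductSpace ℂ H]

/-- The algebraic `n`-th tensor power of `H` over `ℂ`; it gets its own name because it will carry
the Hilbert space inner product, not the projective seminorm that Mathlib puts on `⨂[ℂ]^n H`. -/
def AlgTensor (n : ℕ) : Type _ := ⨂[ℂ]^n H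

instance (n : ℕ) : AddCommGroup (AlgTensor H n) := inferInstanceAs (AddCommGroup (⨂[ℂ]^n H))
instance (n : ℕ) : Module ℂ (AlgTensor H n) := inferInstanceAs (Module ℂ (⨂[ℂ]^n H))

variable {H}

/-- The simple tensor `x₁ ⊗ ⋯ ⊗ xₙ`, as a multilinear map of its factors. -/
def algPure (n : ℕ) : MultilinearMap ℂ (fun _ : Fin n => H) (AlgTensor H n) :=
  PiTensorProduct.tprod ℂ

/-- Linear maps out of the tensor power that are prescribed on simple tensors. -/
def algLift {n : ℕ} {E : Type*} [AddCommGroup E] [Module ℂ E]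
    (f : MultilinearMap ℂ (fun _ : Fin n => H) E) : AlgTensor H n →ₗ[ℂ] E :=
  PiTensorProduct.lift f

theorem algLift_pure {n : ℕ} {E : Type*} [AddCommGroup E] [Module ℂ E]
    (f : MultilinearMap ℂ (fun _ : Fin n => H) E) (x : Fin n → H) :
    algLift f (algPure n x) = f x :=
  PiTensorProduct.lift.tprod x

theorem span_algPure (n : ℕ) :
    Submodule.span ℂ (Set.range (algPure (H := H) n)) = ⊤ :=
  PiTensorProduct.span_tprod_eq_top

@[elab_as_elim]
theorem algTensor_induction {n : ℕ} {p : AlgTensor H n → Prop} (z : AlgTensor H n)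
    (h₀ : p 0) (h₁ : ∀ x, p (algPure n x)) (h₂ : ∀ (c : ℂ) a, p a → p (c • a))
    (h₃ : ∀ a b, p a → p b → p (a + b)) : p z := by
  have hz : z ∈ Submodule.span ℂ (Set.range (algPure (H := H) n)) := by
    rw [span_algPure]; trivial
  induction hz using Submodule.span_induction with
  | mem x hx => obtain ⟨y, rfl⟩ := hx; exact h₁ y
  | zero => exact h₀
  | add x y _ _ hx hy => exact h₃ x y hx hy
  | smul c x _ hx => exact h₂ c x hx

/-- The linear functional `y₁ ⊗ ⋯ ⊗ yₙ ↦ ∏ᵢ ⟪xᵢ, yᵢ⟫`. -/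
def pureFunctional {n : ℕ} (x : Fin n → H) : AlgTensor H n →ₗ[ℂ] ℂ :=
  algLift ((MultilinearMap.mkPiAlgebra ℂ (Fin n) ℂ).compLinearMap
    fun i => (innerSL ℂ (x i) : H →ₗ[ℂ] ℂ))

theorem pureFunctional_pure {n : ℕ} (x y : Fin n → H) :
    pureFunctional x (algPure n y) = ∏ i, ⟪x i, y i⟫_ℂ := by
  simp [pureFunctional, algLift_pure]

theorem pureFunctional_update_add {n : ℕ} [DecidableEq (Fin n)] (x : Fin n → H) (i : Fin n)
    (a b : H) (w : AlgTensor H n) :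
    pureFunctional (Function.update x i (a + b)) w
      = pureFunctional (Function.update x i a) w + pureFunctional (Function.update x i b) w := by
  refine algTensor_induction w (by simp) (fun y => ?_) (fun c a h => ?_) (fun a b ha hb => ?_)
  · simp only [pureFunctional_pure]
    rw [← Finset.mul_prod_erase _ _ (Finset.mem_univ i),
      ← Finset.mul_prod_erase _ _ (Finset.mem_univ i),
      ← Finset.mul_prod_erase _ _ (Finset.mem_univ i)]
    have e : ∀ c : H, ∏ j ∈ Finset.univ.erase i, ⟪Function.update x i c j, y j⟫_ℂ
        = ∏ j ∈ Finset.univ.erase i, ⟪x j, y j⟫_ℂ := fun c =>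
      Finset.prod_congr rfl fun j hj => by
        rw [Function.update_of_ne (Finset.ne_of_mem_erase hj)]
    simp only [e, Function.update_self, inner_add_left]
    ring
  · simp only [map_smul, h, smul_add]
  · simp only [map_add, ha, hb]; ring

theorem pureFunctional_update_smul {n : ℕ} [DecidableEq (Fin n)] (x : Fin n → H) (i : Fin n)
    (c : ℂ) (a : H) (w : AlgTensor H n) :
    pureFunctional (Function.update x i (c • a)) w
      = (starRingEnd ℂ) c * pureFunctional (Function.update x i a) w := by
  refine algTensor_induction w (by simp) (fun y => ?_) (fun d b h => ?_) (fun a b ha hb => ?_)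
  · simp only [pureFunctional_pure]
    rw [← Finset.mul_prod_erase _ _ (Finset.mem_univ i),
      ← Finset.mul_prod_erase _ _ (Finset.mem_univ i)]
    have e : ∀ c : H, ∏ j ∈ Finset.univ.erase i, ⟪Function.update x i c j, y j⟫_ℂ
        = ∏ j ∈ Finset.univ.erase i, ⟪x j, y j⟫_ℂ := fun c =>
      Finset.prod_congr rfl fun j hj => by
        rw [Function.update_of_ne (Finset.ne_of_mem_erase hj)]
    simp only [e, Function.update_self, inner_smul_left]
    ring
  · simp only [map_smul, h, smul_eq_mul]; ring
  · simp only [map_add, ha, hb]; ring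

/-- For fixed `w`, the multilinear map `x ↦ conj (⟪x₁ ⊗ ⋯ ⊗ xₙ, w⟫)`. -/
def conjPairing {n : ℕ} (w : AlgTensor H n) : MultilinearMap ℂ (fun _ : Fin n => H) ℂ where
  toFun x := (starRingEnd ℂ) (pureFunctional x w)
  map_update_add' x i a b := by simp [pureFunctional_update_add]
  map_update_smul' x i c a := by simp [pureFunctional_update_smul]

/-- The sesquilinear form with `⟪x₁ ⊗ ⋯ ⊗ xₙ, y₁ ⊗ ⋯ ⊗ yₙ⟫ = ∏ᵢ ⟪xᵢ, yᵢ⟫`. -/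
def algInner {n : ℕ} (z w : AlgTensor H n) : ℂ := (starRingEnd ℂ) (algLift (conjPairing w) z)

theorem algInner_pure_left {n : ℕ} (x : Fin n → H) (w : AlgTensor H n) :
    algInner (algPure n x) w = pureFunctional x w := by
  simp [algInner, algLift_pure, conjPairing]

theorem algInner_add_left {n : ℕ} (a b w : AlgTensor H n) :
    algInner (a + b) w = algInner a w + algInner b w := by
  simp [algInner]

theorem algInner_smul_left {n : ℕ} (c : ℂ) (a w : AlgTensor H n) :
    algInner (c • a) w = (starRingEnd ℂ) c * algInner a w := by
  simp [algInner]

theorem algInner_zero_left {n : ℕ} (w : AlgTensor H n) : algInner 0 w = 0 := by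
  simp [algInner]

theorem algInner_add_right {n : ℕ} (z a b : AlgTensor H n) :
    algInner z (a + b) = algInner z a + algInner z b := by
  refine algTensor_induction z (by simp [algInner_zero_left]) (fun y => ?_) (fun d b h => ?_)
    (fun a b ha hb => ?_)
  · simp [algInner_pure_left]
  · simp [algInner_smul_left, h, mul_add]
  · simp only [algInner_add_left, ha, hb]; ring

theorem algInner_smul_right {n : ℕ} (c : ℂ) (z a : AlgTensor H n) :
    algInner z (c • a) = c * algInner z a := by
  refine algTensor_induction z (by simp [algInner_zero_left]) (fun y => ?_) (fun d b h => ?_)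
    (fun a b ha hb => ?_)
  · simp [algInner_pure_left]
  · simp only [algInner_smul_left, h]; ring
  · simp only [algInner_add_left, ha, hb]; ring

theorem algInner_zero_right {n : ℕ} (z : AlgTensor H n) : algInner z 0 = 0 := by
  simpa using algInner_smul_right 0 z 0

theorem algInner_conj_symm {n : ℕ} (z w : AlgTensor H n) :
    (starRingEnd ℂ) (algInner w z) = algInner z w := by
  refine algTensor_induction z (by simp [algInner_zero_left, algInner_zero_right]) (fun x => ?_)
    (fun d b h => ?_) (fun a b ha hb => ?_)
  · refine algTensor_induction w (by simp [algInner_zero_left, algInner_zero_right]) (fun y => ?_)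
      (fun d b h => ?_) (fun a b ha hb => ?_)
    · simp [algInner_pure_left, pureFunctional_pure]
    · simp [algInner_smul_left, algInner_smul_right, h]
    · simp [algInner_add_left, algInner_add_right, ha, hb]
  · simp [algInner_smul_left, algInner_smul_right, h]
  · simp [algInner_add_left, algInner_add_right, ha, hb]

open scoped ComplexOrder in
theorem posSemidef_prod_gram {n r : ℕ} (x : Fin r → Fin n → H) (s : Finset (Fin n)) :
    (Matrix.of fun k l => ∏ i ∈ s, ⟪x k i, x l i⟫_ℂ : Matrix (Fin r) (Fin r) ℂ).PosSemidef := by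
  classical
  induction s using Finset.induction_on with
  | empty =>
    have h : (Matrix.of fun k l => ∏ i ∈ (∅ : Finset (Fin n)), ⟪x k i, x l i⟫_ℂ :
        Matrix (Fin r) (Fin r) ℂ) = Matrix.gram ℂ (fun _ : Fin r => (1 : ℂ)) := by
      ext k l
      simp [Matrix.gram]
    rw [h]
    exact Matrix.posSemidef_gram ℂ _
  | insert i s hi ih =>
    have h : (Matrix.of fun k l => ∏ i ∈ insert i s, ⟪x k i, x l i⟫_ℂ :
        Matrix (Fin r) (Fin r) ℂ) = (Matrix.gram ℂ (fun k => x k i)).hadamard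
          (Matrix.of fun k l => ∏ i ∈ s, ⟪x k i, x l i⟫_ℂ) := by
      ext k l
      simp [Matrix.gram, Finset.prod_insert hi]
    rw [h]
    exact (Matrix.posSemidef_gram ℂ _).hadamard ih

open scoped ComplexOrder in
theorem algInner_self_nonneg {n : ℕ} (z : AlgTensor H n) : 0 ≤ RCLike.re (algInner z z) := by
  have hz : z ∈ Submodule.span ℂ (Set.range (algPure (H := H) n)) := by
    rw [span_algPure]; trivial
  obtain ⟨r, c, g, rfl⟩ := Submodule.mem_span_set'.1 hz
  choose x hx using fun k => (g k).2
  have hl : ∀ w, algInner (∑ k, c k • (g k : AlgTensor H n)) w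
      = ∑ k, (starRingEnd ℂ) (c k) * algInner (g k : AlgTensor H n) w := fun w => by
    have : ∀ s : Finset (Fin r), algInner (∑ k ∈ s, c k • (g k : AlgTensor H n)) w
      = ∑ k ∈ s, (starRingEnd ℂ) (c k) * algInner (g k : AlgTensor H n) w := by
      intro s
      simp [algInner]
    exact this _
  have hr : ∀ k, algInner (g k : AlgTensor H n) (∑ l, c l • (g l : AlgTensor H n))
      = ∑ l, c l * ∏ i, ⟪x k i, x l i⟫_ℂ := fun k => by
    rw [← hx k, algInner_pure_left, map_sum]
    refine Finset.sum_congr rfl fun l _ => ?_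
    rw [← hx l, map_smul, pureFunctional_pure, smul_eq_mul]
  have hp := (posSemidef_prod_gram x Finset.univ).re_dotProduct_nonneg c
  rw [hl]
  simp only [hr]
  convert hp using 2
  simp [dotProduct, Matrix.mulVec, mul_comm]

instance (n : ℕ) : PreInnerProductSpace.Core ℂ (AlgTensor H n) where
  inner := algInner
  conj_inner_symm := algInner_conj_symm
  re_inner_nonneg := algInner_self_nonneg
  add_left := algInner_add_left
  smul_left z w c := algInner_smul_left c z w

instance (n : ℕ) : SeminormedAddCommGroup (AlgTensor H n) :=
  InnerProductSpace.Core.toSeminormedAddCommGroup (𝕜 := ℂ)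

instance (n : ℕ) : InnerProductSpace ℂ (AlgTensor H n) := InnerProductSpace.ofCore inferInstance

theorem inner_algPure {n : ℕ} (x y : Fin n → H) :
    ⟪algPure n x, algPure n y⟫_ℂ = ∏ i, ⟪x i, y i⟫_ℂ :=
  (algInner_pure_left x _).trans (pureFunctional_pure x y)

variable (H) in
/-- The Hilbert tensor power `H^{⊗n}`: the completion of the algebraic tensor power. -/
def HTensor (n : ℕ) : Type _ := Completion (AlgTensor H n)

instance (n : ℕ) : NormedAddCommGroup (HTensor H n) :=
  inferInstanceAs (NormedAddCommGroup (Completion (AlgTensor H n)))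
instance (n : ℕ) : InnerProductSpace ℂ (HTensor H n) :=
  inferInstanceAs (InnerProductSpace ℂ (Completion (AlgTensor H n)))
instance (n : ℕ) : CompleteSpace (HTensor H n) :=
  inferInstanceAs (CompleteSpace (Completion (AlgTensor H n)))

/-- The inclusion of the algebraic tensor power into the Hilbert tensor power. -/
def toHTensor (n : ℕ) : AlgTensor H n →ₗ[ℂ] HTensor H n :=
  (Completion.toComplL : AlgTensor H n →L[ℂ] HTensor H n).toLinearMap

theorem denseRange_toHTensor (n : ℕ) : DenseRange (toHTensor (H := H) n) :=
  Completion.denseRange_coe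

theorem norm_toHTensor {n : ℕ} (a : AlgTensor H n) : ‖toHTensor n a‖ = ‖a‖ :=
  Completion.norm_coe a

/-- The simple tensor `x₁ ⊗ ⋯ ⊗ xₙ` in `H^{⊗n}`. -/
def pureTensor {n : ℕ} (x : Fin n → H) : HTensor H n := toHTensor n (algPure n x)

theorem inner_pureTensor {n : ℕ} (x y : Fin n → H) :
    ⟪pureTensor x, pureTensor y⟫_ℂ = ∏ i, ⟪x i, y i⟫_ℂ :=
  (Completion.inner_coe _ _).trans (inner_algPure x y)

/-! ### The permutation operators -/

/-- The permutation operator on the algebraic tensor power. -/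
def algPerm {n : ℕ} (π : Equiv.Perm (Fin n)) : AlgTensor H n →ₗ[ℂ] AlgTensor H n :=
  (PiTensorProduct.reindex ℂ (fun _ : Fin n => H) π).toLinearMap

theorem algPerm_pure {n : ℕ} (π : Equiv.Perm (Fin n)) (x : Fin n → H) :
    algPerm π (algPure n x) = algPure n fun i => x (π⁻¹ i) :=
  PiTensorProduct.reindex_tprod π x

theorem inner_algPerm {n : ℕ} (π : Equiv.Perm (Fin n)) (z w : AlgTensor H n) :
    ⟪algPerm π z, algPerm π w⟫_ℂ = ⟪z, w⟫_ℂ := by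
  refine algTensor_induction z (by simp) (fun x => ?_) (fun d b h => ?_) (fun a b ha hb => ?_)
  · refine algTensor_induction w (by simp) (fun y => ?_) (fun d b h => ?_) (fun a b ha hb => ?_)
    · rw [algPerm_pure, algPerm_pure, inner_algPure, inner_algPure]
      exact Equiv.prod_comp π⁻¹ (fun i => ⟪x i, y i⟫_ℂ)
    · simp only [map_smul, inner_smul_right, h]
    · simp only [map_add, inner_add_right, ha, hb]
  · simp only [map_smul, inner_smul_left, h]
  · simp only [map_add, inner_add_left, ha, hb]

theorem norm_algPerm {n : ℕ} (π : Equiv.Perm (Fin n)) (z : AlgTensor H n) :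
    ‖algPerm π z‖ = ‖z‖ := by
  rw [@norm_eq_sqrt_re_inner ℂ, inner_algPerm, ← @norm_eq_sqrt_re_inner ℂ]

/-- The operator `U_π` on `H^{⊗n}`, the continuous extension of
`x₁ ⊗ ⋯ ⊗ xₙ ↦ x_{π⁻¹(1)} ⊗ ⋯ ⊗ x_{π⁻¹(n)}`. -/
def permOp {n : ℕ} (π : Equiv.Perm (Fin n)) : HTensor H n →L[ℂ] HTensor H n :=
  (toHTensor n ∘ₗ algPerm π).extendOfNorm (toHTensor n)

theorem permOp_coe {n : ℕ} (π : Equiv.Perm (Fin n)) (z : AlgTensor H n) :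
    permOp π (toHTensor n z) = toHTensor n (algPerm π z) :=
  LinearMap.extendOfNorm_eq (denseRange_toHTensor n)
    ⟨1, fun z => by simp [norm_toHTensor, norm_algPerm]⟩ z

theorem permOp_pure {n : ℕ} (π : Equiv.Perm (Fin n)) (x : Fin n → H) :
    permOp π (pureTensor x) = pureTensor fun i => x (π⁻¹ i) := by
  rw [pureTensor, permOp_coe, algPerm_pure, pureTensor]

/-! ### The product `H^{⊗m} × H^{⊗k} → H^{⊗(m+k)}` -/

/-- Concatenation `(a, b) ↦ a ⊗ b` on algebraic tensor powers, linear in each argument. -/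
def algMul (m k : ℕ) : AlgTensor H m →ₗ[ℂ] AlgTensor H k →ₗ[ℂ] AlgTensor H (m + k) :=
  (TensorProduct.mk ℂ (⨂[ℂ]^m H) (⨂[ℂ]^k H)).compr₂
    (TensorPower.mulEquiv (R := ℂ) (M := H) (n := m) (m := k)).toLinearMap

theorem algMul_pure {m k : ℕ} (x : Fin m → H) (y : Fin k → H) :
    algMul m k (algPure m x) (algPure k y) = algPure (m + k) (Fin.append x y) :=
  TensorPower.tprod_mul_tprod ℂ x y

theorem inner_algMul {m k : ℕ} (a c : AlgTensor H m) (b d : AlgTensor H k) :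
    ⟪algMul m k a b, algMul m k c d⟫_ℂ = ⟪a, c⟫_ℂ * ⟪b, d⟫_ℂ := by
  refine algTensor_induction a (by simp) (fun x => ?_) (fun r a h => ?_) (fun a a' h h' => ?_)
  · refine algTensor_induction c (by simp) (fun y => ?_) (fun r a h => ?_) (fun a a' h h' => ?_)
    · refine algTensor_induction b (by simp) (fun z => ?_) (fun r a h => ?_) (fun a a' h h' => ?_)
      · refine algTensor_induction d (by simp) (fun w => ?_) (fun r a h => ?_)
          (fun a a' h h' => ?_)
        · simp only [algMul_pure, inner_algPure, Fin.prod_univ_add, Fin.append_left,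
            Fin.append_right]
        · simp only [map_smul, inner_smul_right, h]; ring
        · simp only [map_add, inner_add_right, h, h']; ring
      · simp only [map_smul, inner_smul_left, h]; ring
      · simp only [map_add, inner_add_left, h, h']; ring
    · simp only [map_smul, LinearMap.smul_apply, inner_smul_right, h]; ring
    · simp only [map_add, LinearMap.add_apply, inner_add_right, h, h']; ring
  · simp only [map_smul, LinearMap.smul_apply, inner_smul_left, h]; ring
  · simp only [map_add, LinearMap.add_apply, inner_add_left, h, h']; ring

theorem norm_algMul {m k : ℕ} (a : AlgTensor H m) (b : AlgTensor H k) :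
    ‖algMul m k a b‖ = ‖a‖ * ‖b‖ := by
  have h : ‖algMul m k a b‖ ^ 2 = (‖a‖ * ‖b‖) ^ 2 := by
    have h1 : ((‖algMul m k a b‖ : ℂ)) ^ 2 = ((‖a‖ : ℂ) * (‖b‖ : ℂ)) ^ 2 := by
      have := inner_algMul a a b b
      rw [inner_self_eq_norm_sq_to_K, inner_self_eq_norm_sq_to_K,
        inner_self_eq_norm_sq_to_K] at this
      rw [mul_pow]; exact this
    exact_mod_cast h1
  exact (pow_left_inj₀ (norm_nonneg _) (by positivity) two_ne_zero).1 h

/-- For `b` in the algebraic tensor power, the operator `ψ ↦ ψ ⊗ b` on `H^{⊗m}`. -/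
def mulRightAlg (m k : ℕ) (b : AlgTensor H k) : HTensor H m →L[ℂ] HTensor H (m + k) :=
  (toHTensor (m + k) ∘ₗ (algMul m k).flip b).extendOfNorm (toHTensor m)

theorem mulRightAlg_coe {m k : ℕ} (a : AlgTensor H m) (b : AlgTensor H k) :
    mulRightAlg m k b (toHTensor m a) = toHTensor (m + k) (algMul m k a b) :=
  LinearMap.extendOfNorm_eq (denseRange_toHTensor m)
    ⟨‖b‖, fun a => by simp [norm_toHTensor, norm_algMul, mul_comm]⟩ a

theorem mulRightAlg_norm_le {m k : ℕ} (b : AlgTensor H k) : ‖mulRightAlg m k b‖ ≤ ‖b‖ := by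
  refine ContinuousLinearMap.opNorm_le_bound _ (norm_nonneg _) fun ψ => ?_
  refine (denseRange_toHTensor m).induction_on (p := fun ψ => ‖mulRightAlg m k b ψ‖ ≤ ‖b‖ * ‖ψ‖) ψ
    (isClosed_le (by fun_prop) (by fun_prop)) fun a => ?_
  rw [mulRightAlg_coe, norm_toHTensor, norm_toHTensor, norm_algMul, mul_comm]

theorem htensor_ext {m : ℕ} {E : Type*} [NormedAddCommGroup E] [NormedSpace ℂ E]
    {S T : HTensor H m →L[ℂ] E} (h : ∀ a, S (toHTensor m a) = T (toHTensor m a)) : S = T :=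
  ContinuousLinearMap.ext fun ψ => (denseRange_toHTensor m).induction_on
    (p := fun ψ => S ψ = T ψ) ψ (isClosed_eq S.continuous T.continuous) h

/-- `mulRightAlg` as a linear map of `b`. -/
def mulRightLin (m k : ℕ) : AlgTensor H k →ₗ[ℂ] (HTensor H m →L[ℂ] HTensor H (m + k)) where
  toFun := mulRightAlg m k
  map_add' b b' := htensor_ext fun a => by simp [mulRightAlg_coe]
  map_smul' c b := htensor_ext fun a => by simp [mulRightAlg_coe]

/-- The continuous bilinear product: `mulRight m k φ ψ = ψ ⊗ φ` for `ψ ∈ H^{⊗m}` and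
`φ ∈ H^{⊗k}`. -/
def mulRight (m k : ℕ) : HTensor H k →L[ℂ] (HTensor H m →L[ℂ] HTensor H (m + k)) :=
  (mulRightLin m k).extendOfNorm (toHTensor k)

theorem mulRight_coe {m k : ℕ} (b : AlgTensor H k) (a : AlgTensor H m) :
    mulRight m k (toHTensor k b) (toHTensor m a) = toHTensor (m + k) (algMul m k a b) := by
  have : mulRight m k (toHTensor k b) = mulRightLin m k b :=
    LinearMap.extendOfNorm_eq (denseRange_toHTensor k)
      ⟨1, fun b => by rw [one_mul, norm_toHTensor]; exact mulRightAlg_norm_le b⟩ b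
  rw [this]
  exact mulRightAlg_coe a b

theorem mulRight_pure {m k : ℕ} (x : Fin m → H) (y : Fin k → H) :
    mulRight m k (pureTensor y) (pureTensor x) = pureTensor (Fin.append x y) := by
  rw [pureTensor, pureTensor, mulRight_coe, algMul_pure, pureTensor]

/-! ### Antisymmetric tensors -/

variable (H) in
/-- The subspace of antisymmetric vectors in `H^{⊗n}`. -/
def antisym (n : ℕ) : Submodule ℂ (HTensor H n) where
  carrier := {ψ | ∀ π : Equiv.Perm (Fin n), permOp π ψ = ((Equiv.Perm.sign π : ℤ) : ℂ) • ψ}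
  add_mem' {a b} ha hb π := by rw [map_add, ha π, hb π, smul_add]
  zero_mem' π := by simp
  smul_mem' c a ha π := by rw [map_smul, ha π, smul_comm]

theorem isClosed_antisym (n : ℕ) : IsClosed (antisym H n : Set (HTensor H n)) := by
  have : (antisym H n : Set (HTensor H n))
      = ⋂ π : Equiv.Perm (Fin n), {ψ | permOp π ψ = ((Equiv.Perm.sign π : ℤ) : ℂ) • ψ} := by
    ext ψ; simp [antisym]
  rw [this]
  exact isClosed_iInter fun π => isClosed_eq (by fun_prop) (by fun_prop)

instance (n : ℕ) : CompleteSpace (antisym H n) := (isClosed_antisym n).completeSpace_coe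

variable (H) in
/-- The antisymmetrizer `A_n = (1/n!) ∑_π sgn(π) U_π`. -/
def antisymmetrizer (n : ℕ) : HTensor H n →L[ℂ] HTensor H n :=
  ((n ! : ℂ)⁻¹) • ∑ π : Equiv.Perm (Fin n), ((Equiv.Perm.sign π : ℤ) : ℂ) • permOp π

theorem permOp_mul {n : ℕ} (π σ : Equiv.Perm (Fin n)) (ψ : HTensor H n) :
    permOp (π * σ) ψ = permOp π (permOp σ ψ) := by
  have h : permOp (H := H) (π * σ) = (permOp π).comp (permOp σ) := htensor_ext fun a => by
    refine algTensor_induction a (by simp) (fun x => ?_) (fun c a h => ?_) (fun a b ha hb => ?_)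
    · change permOp _ (pureTensor x) = permOp π (permOp σ (pureTensor x))
      simp only [permOp_pure]
      rfl
    · simp only [map_smul, h]
    · simp only [map_add, ha, hb]
  rw [h]; rfl

theorem antisymmetrizer_mem {n : ℕ} (ψ : HTensor H n) : antisymmetrizer H n ψ ∈ antisym H n := by
  intro π
  have hs : ∀ σ : Equiv.Perm (Fin n), ((Equiv.Perm.sign σ : ℤ) : ℂ)
      = ((Equiv.Perm.sign π : ℤ) : ℂ) * ((Equiv.Perm.sign (π * σ) : ℤ) : ℂ) := fun σ => by
    rw [Equiv.Perm.sign_mul]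
    rcases Int.units_eq_one_or (Equiv.Perm.sign π) with h | h <;> simp [h]
  simp only [antisymmetrizer, _root_.smul_apply, _root_.sum_apply,
    map_smul, map_sum, ← permOp_mul]
  rw [smul_comm _ ((n ! : ℂ)⁻¹)]
  congr 1
  rw [Finset.smul_sum]
  refine Fintype.sum_equiv (Equiv.mulLeft π) _ _ fun σ => ?_
  rw [smul_smul, Equiv.coe_mulLeft, ← hs]

/-- The vector `√(n!) A_n (x₁ ⊗ ⋯ ⊗ xₙ)`; a Slater determinant when the `xᵢ` are orthonormal. -/
def slater {n : ℕ} (x : Fin n → H) : antisym H n :=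
  ⟨((√(n ! : ℝ) : ℝ) : ℂ) • antisymmetrizer H n (pureTensor x),
    (antisym H n).smul_mem _ (antisymmetrizer_mem _)⟩

end TensorPower

/-! ## Trace and trace norm -/

section Trace

variable {K : Type*} [NormedAddCommGroup K] [InnerProductSpace ℂ K] [CompleteSpace K]

variable (K) in
/-- The index set of a chosen orthonormal basis of the Hilbert space `K`. -/
def onbIndex : Set K := (exists_hilbertBasis ℂ K).choose

variable (K) in
/-- A chosen orthonormal basis of the Hilbert space `K`. -/
def onb : HilbertBasis (onbIndex K) ℂ K := (exists_hilbertBasis ℂ K).choose_spec.choose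

/-- The trace `∑ᵢ ⟪eᵢ, T eᵢ⟫ ∈ [0, ∞]` of a nonnegative operator `T` (for nonnegative operators it
does not depend on the orthonormal basis; it is only ever used for these). -/
def posTrace (T : K →L[ℂ] K) : ℝ≥0∞ :=
  ∑' i : onbIndex K, ENNReal.ofReal (RCLike.re ⟪onb K i, T (onb K i)⟫_ℂ)

/-- The trace norm `‖T‖₁ = Tr |T| ∈ [0, ∞]`, where `|T| = √(T† T)`; the operator `T` is trace
class if and only if it is finite. -/
def traceNorm (T : K →L[ℂ] K) : ℝ≥0∞ := posTrace (CFC.abs T)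

end Trace

/-! ## Fock space and reduced number densities -/

section Fock

variable (H : Type*) [NormedAddCommGroup H] [InnerProductSpace ℂ H]

/-- The fermion Fock space: the Hilbert space direct sum of the antisymmetric subspaces. -/
abbrev Fock : Type _ := lp (fun n : ℕ => antisym H n) 2

/-- The inclusion of the `n`-particle space in Fock space. -/
def incl (n : ℕ) : antisym H n →L[ℂ] Fock H :=
  lp.singleContinuousLinearMap ℂ (fun n : ℕ => antisym H n) 2 n

variable {H}

/-- The `n`-particle block `D_n` of an operator `D` on Fock space. -/
def block (n : ℕ) (D : Fock H →L[ℂ] Fock H) : antisym H n →L[ℂ] antisym H n :=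
  (incl H n).adjoint ∘L D ∘L incl H n

variable (H) in
/-- The orthogonal projector of Fock space onto its `n`-particle subspace, i.e. the spectral
projector of the number operator for the eigenvalue `n`. -/
def sectorProj (n : ℕ) : Fock H →L[ℂ] Fock H := incl H n ∘L (incl H n).adjoint

/-- A density operator on Fock space that commutes with the number operator (i.e. with all its
spectral projectors) and all of whose number moments `∑ₙ n^m Tr (D_n)` are finite. -/
structure IsDensityWithMoments (D : Fock H →L[ℂ] Fock H) : Prop where
  isPositive : D.IsPositive
  trace_eq_one : posTrace D = 1
  commute : ∀ n, Commute D (sectorProj H n)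
  moment_lt_top : ∀ m : ℕ, ∑' n : ℕ, (n : ℝ≥0∞) ^ m * posTrace (block n D) < ∞

/-- The extension `T̄ = T ⊕ 0` to `H^{⊗n}` of an operator `T` on the antisymmetric subspace. -/
def extendByZero {n : ℕ} (T : antisym H n →L[ℂ] antisym H n) : HTensor H n →L[ℂ] HTensor H n :=
  (antisym H n).subtypeL ∘L T ∘L (antisym H n).orthogonalProjectionOnto

/-- The partial trace `T ↦ T_{:m}` from the trace class operators on the antisymmetric subspace of
`H^{⊗(m+k)}` to those on the antisymmetric subspace of `H^{⊗m}`: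
`⟪ξ, T_{:m} ψ⟫ = ∑_φ ⟪ξ ⊗ φ, T̄ (ψ ⊗ φ)⟫`, where `φ` runs over an orthonormal basis of `H^{⊗k}`.
With `V_φ ψ = ψ ⊗ φ` this is `T_{:m} = ∑_φ V_φ† T̄ V_φ`; for trace class `T` the sum converges
absolutely and does not depend on the basis. -/
def partialTrace (m k : ℕ) (T : antisym H (m + k) →L[ℂ] antisym H (m + k)) :
    antisym H m →L[ℂ] antisym H m :=
  ∑' i : onbIndex (HTensor H k),
    (mulRight m k (onb (HTensor H k) i) ∘L (antisym H m).subtypeL).adjoint ∘L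
      extendByZero T ∘L (mulRight m k (onb (HTensor H k) i) ∘L (antisym H m).subtypeL)

/-- The reduced number density operator of order `m`,
`𝒩_m(D) = ∑_{n ≥ m} n!/(n-m)! (D_n)_{:m}`, with the summation index written as `n = m + k`. -/
def reducedDensity (m : ℕ) (D : Fock H →L[ℂ] Fock H) : antisym H m →L[ℂ] antisym H m :=
  ∑' k : ℕ, (((m + k)! : ℂ) / (k ! : ℂ)) • partialTrace m k (block (m + k) D)

/-! ## Gibbs-type quasifree densities -/

variable {J : Type*}

open Classical in
/-- The occupation number `N_j(s)`: it is `1` if `j ∈ s` and `0` otherwise. -/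
def occupation (j : J) (s : Finset J) : ℕ := if j ∈ s then 1 else 0

/-- The occupation numbers `N_j` are independent with respect to the probability measure `ℙ` on
the finite subsets of `J` (all sets of finite subsets being measurable). -/
def IndependentOccupations (ℙ : PMF (Finset J)) : Prop :=
  letI : MeasurableSpace (Finset J) := ⊤
  ProbabilityTheory.iIndepFun (fun (j : J) (s : Finset J) => occupation j s) ℙ.toMeasure

/-- The occupation number basis vector `Ψ(s)` of Fock space: the Slater determinant of the basis
vectors `b j`, `j ∈ s`, taken in some enumeration of `s` (which matters only for the sign); for
`s = ∅` it is the vacuum vector. -/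
def occupationVector [CompleteSpace H] (b : HilbertBasis J ℂ H) (s : Finset J) : Fock H :=
  incl H s.card (slater fun i => b (s.equivFin.symm i : J))

/-- The operator `G[ℙ] = ∑_s ℙ(s) P_s`, with `P_s` the orthogonal projector onto the span of
`Ψ(s)`. -/
def quasifreeDensity [CompleteSpace H] (b : HilbertBasis J ℂ H) (ℙ : PMF (Finset J)) :
    Fock H →L[ℂ] Fock H :=
  ∑' s : Finset J, ((ℙ s).toReal : ℂ) • (ℂ ∙ occupationVector b s).starProjection

end Fock

end Fermion

end

noncomputable section

namespace Fermion

open scoped InnerProductSpace ENNReal Nat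
open InnerProductSpace

/-! ## Sums of rank one operators -/

section Dyads

variable {ι K L : Type*} [NormedAddCommGroup K] [InnerProductSpace ℂ K]
  [NormedAddCommGroup L] [InnerProductSpace ℂ L]

/-! Everything is computed with sums of dyads `∑ |vᵢ⟩⟨vᵢ|` with `∑ ‖vᵢ‖² < ∞`. Such an operator is
positive, so its trace norm is its trace `∑ ‖vᵢ‖²`, and compressions `A† · A`, nonnegative multiples
and summable sums stay in this class. `G` is the dyad sum of the vectors `√ℙ(s) Ψ(s)`, hence so are
its blocks, their partial traces and all reduced densities.

Tracing out `k` particles replaces `‖Ψ‖²` by `∑ᵢ ‖Vᵢ† Ψ‖²`, where `Vᵢ ψ = ψ ⊗ eᵢ`. As the vectors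
`fⱼ ⊗ eᵢ` are orthonormal, Bessel bounds this sum by `‖Ψ‖²`; for `m = 1` they form a basis and
Parseval gives equality. With `N` the particle number and `p_j = ℙ(N_j = 1)`, this yields `‖𝒩_m(G)‖₁
≤ E[N(N-1)⋯(N-m+1)]` and `‖𝒩_1(G)‖₁ = E[N] = ∑ p_j`.

The factorial moment counts injections of `Fin m` into the occupied set. By independence it equals
`∑ ∏ᵢ p_{f(i)}` over injective `f : Fin m → J`, and admitting all `f` gives at most `(∑ p_j)^m`
(`tsum_mul_descFactorial_le`). Finiteness of `∑ p_j` also follows from independence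
(`tsum_occupationProb_ne_top`), because some finite set has positive probability. -/

theorem ofReal_re_inner_self_mul (x y : K) :
    ENNReal.ofReal (RCLike.re (⟪y, x⟫_ℂ * ⟪x, y⟫_ℂ)) = ‖⟪x, y⟫_ℂ‖ₑ ^ 2 := by
  rw [← inner_conj_symm y x, RCLike.conj_mul, ← ofReal_norm,
    ← ENNReal.ofReal_pow (norm_nonneg _)]
  congr 1
  norm_cast

/-- Bessel's inequality in `[0, ∞]`. -/
theorem tsum_enorm_inner_sq_le {v : ι → K} (hv : Orthonormal ℂ v) (x : K) :
    ∑' i, ‖⟪v i, x⟫_ℂ‖ₑ ^ 2 ≤ ‖x‖ₑ ^ 2 := by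
  simp only [← ofReal_norm, ← ENNReal.ofReal_pow (norm_nonneg _)]
  rw [← ENNReal.ofReal_tsum_of_nonneg (fun i => by positivity) (hv.inner_products_summable x)]
  exact ENNReal.ofReal_le_ofReal (hv.tsum_inner_products_le x)

/-- Parseval's identity in `[0, ∞]`. -/
theorem tsum_enorm_inner_sq (e : HilbertBasis ι ℂ K) (x : K) :
    ∑' i, ‖⟪e i, x⟫_ℂ‖ₑ ^ 2 = ‖x‖ₑ ^ 2 := by
  simp only [← ofReal_norm, ← ENNReal.ofReal_pow (norm_nonneg _)]
  rw [← ENNReal.ofReal_tsum_of_nonneg (fun i => by positivity)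
    (e.orthonormal.inner_products_summable x)]
  congr 1
  have h := (RCLike.reCLM (K := ℂ)).hasSum (e.hasSum_inner_mul_inner x x)
  have h2 : RCLike.re ⟪x, x⟫_ℂ = ‖x‖ ^ 2 := inner_self_eq_norm_sq x
  rw [← h2]
  refine Eq.trans (tsum_congr fun i => ?_) h.tsum_eq
  simp only [RCLike.reCLM_apply]
  rw [← inner_conj_symm x (e i), RCLike.conj_mul]
  norm_cast

/-- The operator `∑ᵢ |vᵢ⟩⟨vᵢ|`. -/
def dyadSum (v : ι → K) : K →L[ℂ] K := ∑' i, rankOne ℂ (v i) (v i)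

/-- The dyad of `v` has operator norm `‖v‖²`, so the series converges absolutely in operator norm.
-/
theorem summable_rankOne [CompleteSpace K] {v : ι → K} (hv : ∑' i, ‖v i‖ₑ ^ 2 ≠ ∞) :
    Summable fun i => rankOne ℂ (v i) (v i) := by
  refine Summable.of_norm ?_
  have h := ENNReal.summable_toReal hv
  simpa [sq] using h

theorem hasSum_dyadSum [CompleteSpace K] {v : ι → K} (hv : ∑' i, ‖v i‖ₑ ^ 2 ≠ ∞) :
    HasSum (fun i => rankOne ℂ (v i) (v i)) (dyadSum v) :=
  (summable_rankOne hv).hasSum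

theorem enorm_map_sq_le (A : K →L[ℂ] L) (x : K) : ‖A x‖ₑ ^ 2 ≤ ‖A‖ₑ ^ 2 * ‖x‖ₑ ^ 2 := by
  rw [← mul_pow]
  gcongr
  exact A.le_opENorm x

theorem tsum_enorm_map_sq_ne_top (A : K →L[ℂ] L) {v : ι → K} (hv : ∑' i, ‖v i‖ₑ ^ 2 ≠ ∞) :
    ∑' i, ‖A (v i)‖ₑ ^ 2 ≠ ∞ := by
  refine ne_top_of_le_ne_top ?_ (ENNReal.tsum_le_tsum fun i => enorm_map_sq_le A (v i))
  rw [ENNReal.tsum_mul_left]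
  exact ENNReal.mul_ne_top (by simp) hv

theorem isPositive_dyadSum [CompleteSpace K] {v : ι → K} (hv : ∑' i, ‖v i‖ₑ ^ 2 ≠ ∞) :
    (dyadSum v).IsPositive := by
  rw [← ContinuousLinearMap.nonneg_iff_isPositive]
  exact (hasSum_dyadSum hv).nonneg fun i =>
    (ContinuousLinearMap.nonneg_iff_isPositive _).2 (isPositive_rankOne_self (v i))

/-- No summability is required: a divergent `tsum` is `0`, which commutes with everything. -/
theorem commute_dyadSum {v : ι → K} {T : K →L[ℂ] K}
    (h : ∀ i, Commute (rankOne ℂ (v i) (v i)) T) : Commute (dyadSum v) T :=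
  Commute.tsum_left T h

/-- Diagonal entries are `∑ᵢ |⟪y, vᵢ⟫|²`; the two nonnegative sums are interchanged and Parseval is
applied to each `vᵢ`. -/
theorem posTrace_dyadSum [CompleteSpace K] {v : ι → K} (hv : ∑' i, ‖v i‖ₑ ^ 2 ≠ ∞) :
    posTrace (dyadSum v) = ∑' i, ‖v i‖ₑ ^ 2 := by
  have key : ∀ y : K, ENNReal.ofReal (RCLike.re ⟪y, dyadSum v y⟫_ℂ)
      = ∑' i, ‖⟪y, v i⟫_ℂ‖ₑ ^ 2 := by
    intro y
    have h : HasSum (fun i => RCLike.re (⟪v i, y⟫_ℂ * ⟪y, v i⟫_ℂ))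
        (RCLike.re ⟪y, dyadSum v y⟫_ℂ) := by
      have := (hasSum_dyadSum hv).mapL
        ((RCLike.reCLM (K := ℂ)) ∘L
          ((innerSL ℂ y).comp (ContinuousLinearMap.apply ℂ K y)).restrictScalars ℝ)
      simpa [inner_smul_right] using this
    rw [← h.tsum_eq, ENNReal.ofReal_tsum_of_nonneg _ h.summable]
    · exact tsum_congr fun i => ofReal_re_inner_self_mul _ _
    · intro i
      rw [← inner_conj_symm (v i) y, RCLike.conj_mul]
      norm_cast
      positivity
  simp only [posTrace, key]
  rw [ENNReal.tsum_comm]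
  exact tsum_congr fun i => tsum_enorm_inner_sq _ _

theorem traceNorm_dyadSum [CompleteSpace K] {v : ι → K} (hv : ∑' i, ‖v i‖ₑ ^ 2 ≠ ∞) :
    traceNorm (dyadSum v) = ∑' i, ‖v i‖ₑ ^ 2 := by
  rw [traceNorm, CFC.abs_of_nonneg _
    ((ContinuousLinearMap.nonneg_iff_isPositive _).2 (isPositive_dyadSum hv)), posTrace_dyadSum hv]

/-- Termwise `A† |v⟩⟨v| A = |A† v⟩⟨A† v|`. Blocks, extension by zero and the terms of the partial
trace are all compressions of this shape. -/
theorem adjoint_comp_dyadSum_comp [CompleteSpace K] [CompleteSpace L] (A : L →L[ℂ] K) {v : ι → K}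
    (hv : ∑' i, ‖v i‖ₑ ^ 2 ≠ ∞) :
    A.adjoint ∘L dyadSum v ∘L A = dyadSum fun i => A.adjoint (v i) := by
  have h := ((hasSum_dyadSum hv).mapL
    ((ContinuousLinearMap.compL ℂ L K K).flip A)).mapL (ContinuousLinearMap.compL ℂ L K L A.adjoint)
  rw [dyadSum, dyadSum]
  refine h.tsum_eq.symm.trans (tsum_congr fun i => ?_)
  simp [rankOne_comp, comp_rankOne]

theorem tsum_dyadSum [CompleteSpace K] {κ : ι → Type*} {v : ∀ i, κ i → K}
    (hv : ∑' i, ∑' j, ‖v i j‖ₑ ^ 2 ≠ ∞) :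
    ∑' i, dyadSum (v i) = dyadSum fun p : Sigma κ => v p.1 p.2 := by
  have h : ∑' p : Sigma κ, ‖v p.1 p.2‖ₑ ^ 2 ≠ ∞ := by rwa [ENNReal.tsum_sigma']
  refine ((hasSum_dyadSum h).sigma fun i => hasSum_dyadSum ?_).tsum_eq
  exact ne_top_of_le_ne_top hv (ENNReal.le_tsum i)

theorem rankOne_sqrt_smul (c : ℝ) (hc : 0 ≤ c) (x : K) :
    rankOne ℂ (((√c : ℝ) : ℂ) • x) (((√c : ℝ) : ℂ) • x) = (c : ℂ) • rankOne ℂ x x := by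
  ext y
  simp only [rankOne_apply, inner_smul_left, smul_smul, Complex.conj_ofReal, _root_.smul_apply]
  rw [mul_right_comm, ← Complex.ofReal_mul, Real.mul_self_sqrt hc]

theorem smul_dyadSum (v : ι → K) (c : ℝ) (hc : 0 ≤ c) :
    (c : ℂ) • dyadSum v = dyadSum fun i => ((√c : ℝ) : ℂ) • v i := by
  simp only [dyadSum, ← tsum_const_smul'', rankOne_sqrt_smul c hc]

theorem enorm_sqrt_smul_sq (c : ℝ) (hc : 0 ≤ c) (x : K) :
    ‖((√c : ℝ) : ℂ) • x‖ₑ ^ 2 = ENNReal.ofReal c * ‖x‖ₑ ^ 2 := by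
  rw [enorm_smul, mul_pow]
  congr 1
  rw [← ofReal_norm, ← ENNReal.ofReal_pow (norm_nonneg _), Complex.norm_real,
    Real.norm_of_nonneg (Real.sqrt_nonneg c), Real.sq_sqrt hc]

end Dyads

/-! ## Independent occupation numbers -/

section Occupations

theorem tsum_prod_fin {J : Type*} (f : J → ℝ≥0∞) (n : ℕ) :
    ∑' x : Fin n → J, ∏ i, f (x i) = (∑' j, f j) ^ n := by
  induction n with
  | zero => simp
  | succ n ih =>
    rw [← (Fin.consEquiv fun _ : Fin (n + 1) => J).tsum_eq, ENNReal.tsum_prod']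
    simp only [Fin.consEquiv_apply, Fin.prod_univ_succ, Fin.cons_zero, Fin.cons_succ,
      ENNReal.tsum_mul_left, ih, ENNReal.tsum_mul_right, pow_succ']

/-- For `n ≥ 2m` each of the `m` factors of the falling factorial is at least `n + 1 - m ≥ n / 2`.
This reduces power moments to factorial moments. -/
theorem pow_le_add_descFactorial (n m : ℕ) :
    n ^ m ≤ (2 * m) ^ m + 2 ^ m * n.descFactorial m := by
  rcases le_total n (2 * m) with h | h
  · exact (Nat.pow_le_pow_left h m).trans (Nat.le_add_right _ _)
  · refine le_trans ?_ (Nat.le_add_left _ _)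
    calc n ^ m ≤ (2 * (n + 1 - m)) ^ m := Nat.pow_le_pow_left (by omega) m
      _ = 2 ^ m * (n + 1 - m) ^ m := by rw [mul_pow]
      _ ≤ _ := Nat.mul_le_mul_left _ (Nat.pow_sub_le_descFactorial n m)

variable {J : Type*} (ℙ : PMF (Finset J))

/-- The probability `ℙ(N_j = 1)` that `j` is occupied. -/
def occupationProb (j : J) : ℝ≥0∞ := ℙ.toOuterMeasure {s | j ∈ s}

variable {ℙ}

theorem toOuterMeasure_inter_preimage (hℙ : IndependentOccupations ℙ) (t : Finset J) (S : Set ℕ) :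
    ℙ.toOuterMeasure {s | ∀ j ∈ t, occupation j s ∈ S}
      = ∏ j ∈ t, ℙ.toOuterMeasure {s | occupation j s ∈ S} := by
  let _ : MeasurableSpace (Finset J) := ⊤
  have h := (show ProbabilityTheory.iIndepFun (fun (j : J) (s : Finset J) => occupation j s)
    ℙ.toMeasure from hℙ).measure_inter_preimage_eq_mul (S := t) (sets := fun _ => S)
      fun _ _ => MeasurableSet.of_discrete
  simp only [PMF.toMeasure_apply_eq_toOuterMeasure_apply _ (MeasurableSpace.measurableSet_top)] at h
  rw [show {s : Finset J | ∀ j ∈ t, occupation j s ∈ S} =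
      ⋂ i ∈ t, (fun s => occupation i s) ⁻¹' S by
    ext s; simp]
  exact h

theorem toOuterMeasure_subset (hℙ : IndependentOccupations ℙ) (t : Finset J) :
    ℙ.toOuterMeasure {s | t ⊆ s} = ∏ j ∈ t, occupationProb ℙ j := by
  have h := toOuterMeasure_inter_preimage hℙ t {1}
  simpa [occupation, occupationProb, Finset.subset_iff] using h

theorem toOuterMeasure_notMem (j : J) :
    ℙ.toOuterMeasure {s | j ∉ s} = 1 - occupationProb ℙ j := by
  let _ : MeasurableSpace (Finset J) := ⊤
  have h := MeasureTheory.prob_compl_eq_one_sub (μ := ℙ.toMeasure) (s := {s | j ∈ s})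
    (MeasurableSpace.measurableSet_top)
  simp only [PMF.toMeasure_apply_eq_toOuterMeasure_apply _ (MeasurableSpace.measurableSet_top)] at h
  exact h

theorem occupationProb_le_one (j : J) : occupationProb ℙ j ≤ 1 := by
  let _ : MeasurableSpace (Finset J) := ⊤
  rw [occupationProb, ← PMF.toMeasure_apply_eq_toOuterMeasure_apply _
    (MeasurableSpace.measurableSet_top)]
  exact MeasureTheory.prob_le_one

theorem one_sub_le_ofReal_exp (p : ℝ≥0∞) (hp : p ≤ 1) :
    1 - p ≤ ENNReal.ofReal (Real.exp (-p.toReal)) := by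
  lift p to NNReal using ne_top_of_le_ne_top ENNReal.one_ne_top hp
  rw [show (1 : ℝ≥0∞) - p = ENNReal.ofReal ((1 : ℝ) - (p : ℝ)) by
    rw [ENNReal.ofReal_sub _ p.coe_nonneg]; simp]
  refine ENNReal.ofReal_le_ofReal ?_
  have := Real.add_one_le_exp (-(p : ℝ))
  simp only [ENNReal.coe_toReal]
  linarith

/-- Independence forces the expected number of particles to be finite. -/
theorem tsum_occupationProb_ne_top (hℙ : IndependentOccupations ℙ) :
    ∑' j, occupationProb ℙ j ≠ ∞ := by
  classical
  -- A discrete measure has an atom; its probability bounds the tail of `∑ p_j`.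
  obtain ⟨s, hs⟩ := ℙ.support_nonempty
  have hpos : 0 < (ℙ s).toReal := ENNReal.toReal_pos hs (ℙ.apply_ne_top s)
  have hp : ∀ j, occupationProb ℙ j ≠ ∞ := fun j =>
    ne_top_of_le_ne_top ENNReal.one_ne_top (occupationProb_le_one j)
  -- On the outcome `s` all of `t` is empty, so `ℙ(s) ≤ ∏ (1 - p_j) ≤ exp (-∑ p_j)` over `j ∈ t`;
  -- then take logarithms.
  have hdis : ∀ t : Finset J, Disjoint t s →
      ∑ j ∈ t, (occupationProb ℙ j).toReal ≤ -Real.log (ℙ s).toReal := by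
    intro t ht
    have h0 : ℙ.toOuterMeasure {s} ≤
        ℙ.toOuterMeasure {u | ∀ j ∈ t, occupation j u ∈ ({0} : Set ℕ)} := by
      refine MeasureTheory.measure_mono ?_
      rintro _ rfl j hj
      simp [occupation, Finset.disjoint_left.1 ht hj]
    rw [toOuterMeasure_inter_preimage hℙ, PMF.toOuterMeasure_apply_singleton] at h0
    have h1 : ℙ s ≤ ENNReal.ofReal (Real.exp (-∑ j ∈ t, (occupationProb ℙ j).toReal)) := by
      refine h0.trans ?_
      rw [← Finset.sum_neg_distrib, Real.exp_sum,
        ENNReal.ofReal_prod_of_nonneg fun _ _ => (Real.exp_pos _).le]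
      refine Finset.prod_le_prod' fun j _ => ?_
      have := toOuterMeasure_notMem (ℙ := ℙ) j
      simp only [occupation, Set.mem_singleton_iff, ite_eq_right_iff, one_ne_zero, imp_false, this]
      exact one_sub_le_ofReal_exp _ (occupationProb_le_one j)
    have h2 := ENNReal.toReal_le_of_le_ofReal (Real.exp_pos _).le h1
    have h3 := Real.log_le_log hpos h2
    rw [Real.log_exp] at h3
    linarith
  have hsum : Summable fun j => (occupationProb ℙ j).toReal := by
    -- Indices in `s` contribute at most `1` each, the remaining ones are controlled by `hdis`.
    refine summable_of_sum_le (c := s.card + -Real.log (ℙ s).toReal)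
      (fun j => ENNReal.toReal_nonneg) fun t => ?_
    rw [← Finset.sum_inter_add_sum_sdiff t s]
    refine add_le_add ?_ (hdis _ Finset.sdiff_disjoint)
    refine (Finset.sum_le_card_nsmul _ _ 1 fun j _ =>
      ENNReal.toReal_mono ENNReal.one_ne_top (occupationProb_le_one j)).trans ?_
    simp only [nsmul_eq_mul, mul_one]
    exact_mod_cast Finset.card_le_card Finset.inter_subset_right
  rw [show (∑' j, occupationProb ℙ j) = ∑' j, ENNReal.ofReal (occupationProb ℙ j).toReal from
    tsum_congr fun j => (ENNReal.ofReal_toReal (hp j)).symm]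
  exact hsum.tsum_ofReal_ne_top

/-- The expected number of particles. -/
theorem tsum_mul_card : ∑' s, ℙ s * (s.card : ℝ≥0∞) = ∑' j, occupationProb ℙ j := by
  classical
  simp only [occupationProb, PMF.toOuterMeasure_apply]
  rw [ENNReal.tsum_comm]
  refine tsum_congr fun s => ?_
  have : ∀ j, Set.indicator {s : Finset J | j ∈ s} ℙ s = if j ∈ s then ℙ s else 0 := fun j => by
    simp [Set.indicator]
  simp only [this]
  rw [tsum_eq_sum (s := s) (by simp +contextual)]
  simp [mul_comm]

/-- The factorial moments of the number of particles. -/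
theorem tsum_mul_descFactorial_le (hℙ : IndependentOccupations ℙ) (n : ℕ) :
    ∑' s, ℙ s * (s.card.descFactorial n : ℝ≥0∞) ≤ (∑' j, occupationProb ℙ j) ^ n := by
  classical
  -- The falling factorial counts the injections `Fin n ↪ s`, that is, the injections into `J` with
  -- image inside `s`.
  have hcard : ∀ s : Finset J, ℙ s * (s.card.descFactorial n : ℝ≥0∞)
      = ∑' f : Fin n ↪ J, Set.indicator {s : Finset J | Finset.univ.map f ⊆ s} ℙ s := by
    intro s
    let e : (Fin n ↪ s) ↪ (Fin n ↪ J) :=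
      ⟨fun f => f.trans (Function.Embedding.subtype _), fun f g h => by
        ext i; exact congrArg (fun k : Fin n ↪ J => k i) h⟩
    have h1 : ∀ f : Fin n ↪ J, f ∉ Set.range e →
        Set.indicator {s : Finset J | Finset.univ.map f ⊆ s} ℙ s = 0 := by
      intro f hf
      refine Set.indicator_of_notMem (fun h => hf ?_) _
      exact ⟨f.codRestrict s fun i => h (by simp), by ext; rfl⟩
    rw [← e.injective.tsum_eq (f := fun f : Fin n ↪ J =>
      Set.indicator {s : Finset J | Finset.univ.map f ⊆ s} ℙ s)
      (fun f hf => by_contra fun h => hf (h1 f h))]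
    have h2 : ∀ f : Fin n ↪ s,
        Set.indicator {s : Finset J | Finset.univ.map (e f) ⊆ s} ℙ s = ℙ s := fun f =>
      Set.indicator_of_mem (by
        intro j hj
        obtain ⟨i, _, rfl⟩ := Finset.mem_map.1 hj
        exact (f i).2) _
    simp only [h2, tsum_fintype, Finset.sum_const, Finset.card_univ, Fintype.card_embedding_eq,
      Fintype.card_coe, Fintype.card_fin, nsmul_eq_mul, mul_comm]
  simp only [hcard]
  rw [ENNReal.tsum_comm]
  simp only [← PMF.toOuterMeasure_apply, toOuterMeasure_subset hℙ, Finset.prod_map]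
  rw [← tsum_prod_fin]
  -- The inequality arises here: noninjective tuples only add nonnegative terms.
  exact ENNReal.tsum_comp_le_tsum_of_injective (f := fun f : Fin n ↪ J => (f : Fin n → J))
    DFunLike.coe_injective (fun x => ∏ i, occupationProb ℙ (x i))

theorem tsum_mul_card_pow_ne_top (hℙ : IndependentOccupations ℙ) (m : ℕ) :
    ∑' s, ℙ s * (s.card : ℝ≥0∞) ^ m ≠ ∞ := by
  have h : ∀ s, ℙ s * (s.card : ℝ≥0∞) ^ m ≤
      ℙ s * (2 * m : ℕ) ^ m + 2 ^ m * (ℙ s * (s.card.descFactorial m : ℝ≥0∞)) := fun s => by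
    have : (s.card : ℝ≥0∞) ^ m ≤ (2 * m : ℕ) ^ m + 2 ^ m * (s.card.descFactorial m : ℝ≥0∞) := by
      exact_mod_cast pow_le_add_descFactorial s.card m
    calc _ ≤ ℙ s * ((2 * m : ℕ) ^ m + 2 ^ m * (s.card.descFactorial m : ℝ≥0∞)) := by gcongr
      _ = _ := by ring
  refine ne_top_of_le_ne_top ?_ (ENNReal.tsum_le_tsum h)
  rw [ENNReal.tsum_add, ENNReal.tsum_mul_right, ENNReal.tsum_mul_left, ℙ.tsum_coe, one_mul]
  refine ENNReal.add_ne_top.2 ⟨ENNReal.pow_ne_top (ENNReal.natCast_ne_top _),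
    ENNReal.mul_ne_top (ENNReal.pow_ne_top (by simp)) ?_⟩
  exact ne_top_of_le_ne_top (ENNReal.pow_ne_top (tsum_occupationProb_ne_top hℙ))
    (tsum_mul_descFactorial_le hℙ m)

end Occupations

/-! ## Partial traces -/

section Slices

variable {H : Type*} [NormedAddCommGroup H] [InnerProductSpace ℂ H]

/-- The `n!` permuted simple tensors are orthonormal, so their signed sum has squared norm `n!`,
which the factor `√(n!) / n!` normalises. -/
theorem norm_slater {n : ℕ} {x : Fin n → H} (hx : Orthonormal ℂ x) : ‖slater x‖ = 1 := by
  have horth : Orthonormal ℂ fun π : Equiv.Perm (Fin n) => permOp π (pureTensor x) := by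
    classical
    rw [orthonormal_iff_ite]
    intro π σ
    rw [permOp_pure, permOp_pure, inner_pureTensor]
    simp only [orthonormal_iff_ite.1 hx]
    rw [Finset.prod_ite_zero]
    simp only [Finset.prod_const_one, Finset.mem_univ, true_implies]
    refine if_congr ?_ rfl rfl
    rw [← inv_inj (a := π), Equiv.ext_iff]
  have hsum : ‖∑ π : Equiv.Perm (Fin n),
      ((Equiv.Perm.sign π : ℤ) : ℂ) • permOp π (pureTensor x)‖ ^ 2 = (n ! : ℝ) := by
    have h := horth.inner_sum (fun π => ((Equiv.Perm.sign π : ℤ) : ℂ))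
      (fun π => ((Equiv.Perm.sign π : ℤ) : ℂ)) Finset.univ
    have h1 : ∀ π : Equiv.Perm (Fin n), (starRingEnd ℂ) ((Equiv.Perm.sign π : ℤ) : ℂ)
        * ((Equiv.Perm.sign π : ℤ) : ℂ) = 1 := fun π => by
      rcases Int.units_eq_one_or (Equiv.Perm.sign π) with h | h <;> simp [h]
    rw [inner_self_eq_norm_sq_to_K] at h
    simp only [h1, Finset.sum_const, Finset.card_univ, Fintype.card_perm, Fintype.card_fin,
      nsmul_eq_mul, mul_one] at h
    exact Complex.ofReal_injective (by rw [Complex.ofReal_pow, Complex.ofReal_natCast]; exact h)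
  have hn : (0 : ℝ) < n ! := by exact_mod_cast n.factorial_pos
  have : ‖slater x‖ ^ 2 = 1 := by
    rw [Submodule.coe_norm]
    simp only [slater, antisymmetrizer, _root_.smul_apply, _root_.sum_apply]
    rw [norm_smul, norm_smul, mul_pow, mul_pow, hsum]
    simp only [Complex.norm_real, norm_inv, Complex.norm_natCast, Real.norm_eq_abs, sq_abs,
      Real.sq_sqrt hn.le]
    field_simp
  exact (pow_eq_one_iff_of_nonneg (norm_nonneg _) two_ne_zero).1 this

/-! ### Particle-number sectors and blocks. -/

theorem incl_apply (n : ℕ) (x : antisym H n) :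
    incl H n x = lp.single (E := fun n : ℕ => antisym H n) 2 n x := rfl

theorem adjoint_incl_apply (n : ℕ) (f : Fock H) : (incl H n).adjoint f = f n := by
  refine ext_inner_left ℂ fun x => ?_
  rw [ContinuousLinearMap.adjoint_inner_right]
  rw [incl_apply]
  exact lp.inner_single_left (G := fun n : ℕ => antisym H n) n x f

theorem norm_incl (n : ℕ) (x : antisym H n) : ‖incl H n x‖ = ‖x‖ := by
  rw [incl_apply]
  exact lp.norm_single (E := fun n : ℕ => antisym H n) (by norm_num) n x

theorem incl_apply_self (n : ℕ) (x : antisym H n) : (incl H n x : Fock H) n = x := by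
  rw [incl_apply, lp.single_apply_self]

theorem incl_apply_ne {n m : ℕ} (h : m ≠ n) (x : antisym H m) : (incl H m x : Fock H) n = 0 := by
  rw [incl_apply, lp.single_apply_ne _ _ _ h.symm]

theorem sectorProj_incl (n m : ℕ) (x : antisym H m) :
    sectorProj H n (incl H m x) = if m = n then incl H m x else 0 := by
  rw [sectorProj, ContinuousLinearMap.comp_apply, adjoint_incl_apply]
  split_ifs with h
  · subst h
    rw [incl_apply_self]
  · rw [incl_apply_ne h, map_zero]

theorem enorm_incl_apply (n m : ℕ) (x : antisym H m) :
    ‖(incl H m x : Fock H) n‖ₑ = if m = n then ‖x‖ₑ else 0 := by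
  split_ifs with h
  · subst h
    rw [incl_apply_self]
  · rw [incl_apply_ne h, enorm_zero]

theorem commute_rankOne_sectorProj (n m : ℕ) (x : antisym H m) :
    Commute (rankOne ℂ (incl H m x) (incl H m x)) (sectorProj H n) := by
  have hs : (sectorProj H n).adjoint = sectorProj H n := by
    rw [sectorProj, ContinuousLinearMap.adjoint_comp, ContinuousLinearMap.adjoint_adjoint]
  change _ ∘L _ = _ ∘L _
  rw [rankOne_comp, comp_rankOne, hs, sectorProj_incl]
  split_ifs <;> simp

theorem block_dyadSum {ι : Type*} {w : ι → Fock H} (hw : ∑' i, ‖w i‖ₑ ^ 2 ≠ ∞) (n : ℕ) :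
    block n (dyadSum w) = dyadSum fun i => w i n := by
  rw [block, adjoint_comp_dyadSum_comp _ hw]
  simp only [adjoint_incl_apply]

theorem tsum_enorm_apply_sq_ne_top {ι : Type*} {w : ι → Fock H} (hw : ∑' i, ‖w i‖ₑ ^ 2 ≠ ∞)
    (n : ℕ) : ∑' i, ‖w i n‖ₑ ^ 2 ≠ ∞ := by
  have := tsum_enorm_map_sq_ne_top (incl H n).adjoint hw
  simpa only [adjoint_incl_apply] using this

/-! ### Tensoring with a fixed vector: Bessel and Parseval. -/

theorem inner_mulRight {m k : ℕ} (u u' : HTensor H k) (ψ ψ' : HTensor H m) :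
    ⟪mulRight m k u ψ, mulRight m k u' ψ'⟫_ℂ = ⟪ψ, ψ'⟫_ℂ * ⟪u, u'⟫_ℂ := by
  refine (denseRange_toHTensor k).induction_on
    (p := fun u => ⟪mulRight m k u ψ, mulRight m k u' ψ'⟫_ℂ = ⟪ψ, ψ'⟫_ℂ * ⟪u, u'⟫_ℂ) u
    (isClosed_eq (by fun_prop) (by fun_prop)) fun b => ?_
  refine (denseRange_toHTensor k).induction_on
    (p := fun u' => ⟪mulRight m k _ ψ, mulRight m k u' ψ'⟫_ℂ = ⟪ψ, ψ'⟫_ℂ * ⟪_, u'⟫_ℂ) u'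
    (isClosed_eq (by fun_prop) (by fun_prop)) fun b' => ?_
  refine (denseRange_toHTensor m).induction_on
    (p := fun ψ => ⟪mulRight m k _ ψ, mulRight m k _ ψ'⟫_ℂ = ⟪ψ, ψ'⟫_ℂ * _) ψ
    (isClosed_eq (by fun_prop) (by fun_prop)) fun a => ?_
  refine (denseRange_toHTensor m).induction_on
    (p := fun ψ' => ⟪mulRight m k _ _, mulRight m k _ ψ'⟫_ℂ = ⟪_, ψ'⟫_ℂ * _) ψ'
    (isClosed_eq (by fun_prop) (by fun_prop)) fun a' => ?_
  rw [mulRight_coe, mulRight_coe]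
  have hc : ∀ {l : ℕ} (x y : AlgTensor H l), ⟪toHTensor l x, toHTensor l y⟫_ℂ = ⟪x, y⟫_ℂ :=
    fun x y => UniformSpace.Completion.inner_coe x y
  rw [hc, hc, hc, inner_algMul]

/-- The operator `ψ ↦ ψ ⊗ u` on antisymmetric tensors. -/
def tensorRight (m : ℕ) {k : ℕ} (u : HTensor H k) : antisym H m →L[ℂ] HTensor H (m + k) :=
  mulRight m k u ∘L (antisym H m).subtypeL

theorem orthonormal_tensorRight {ι κ : Type*} {m k : ℕ} {e : ι → HTensor H k}
    {f : κ → antisym H m} (he : Orthonormal ℂ e) (hf : Orthonormal ℂ f) :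
    Orthonormal ℂ fun p : ι × κ => tensorRight m (e p.1) (f p.2) := by
  classical
  rw [orthonormal_iff_ite] at *
  rintro ⟨i, j⟩ ⟨i', j'⟩
  simp only [tensorRight, ContinuousLinearMap.comp_apply, Submodule.subtypeL_apply, inner_mulRight,
    ← Submodule.coe_inner, he, hf, Prod.mk.injEq]
  split_ifs <;> simp_all

/-- The closed span absorbs first all `ψ ⊗ eᵢ`, then all `ψ ⊗ u`, hence all simple tensors. The
hypothesis `hm` ensures that every first factor `ψ` is available. -/
theorem dense_span_tensorRight {ι κ : Type*} {m k : ℕ} (e : HilbertBasis ι ℂ (HTensor H k))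
    (f : HilbertBasis κ ℂ (antisym H m)) (hm : antisym H m = ⊤) :
    ⊤ ≤ (Submodule.span ℂ
      (Set.range fun p : ι × κ => tensorRight m (e p.1) (f p.2))).topologicalClosure := by
  set U := (Submodule.span ℂ
    (Set.range fun p : ι × κ => tensorRight m (e p.1) (f p.2))).topologicalClosure with hU
  have hUc : IsClosed (U : Set (HTensor H (m + k))) := Submodule.isClosed_topologicalClosure _
  have h1 : ∀ i ψ, tensorRight m (e i) ψ ∈ U := by
    intro i ψ
    have : (Submodule.span ℂ (Set.range f)).topologicalClosure
        ≤ U.comap (tensorRight m (e i)).toLinearMap := by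
      refine Submodule.topologicalClosure_minimal _ ?_
        (hUc.preimage (tensorRight m (e i)).continuous)
      rw [Submodule.span_le]
      rintro _ ⟨j, rfl⟩
      exact Submodule.le_topologicalClosure _ (Submodule.subset_span ⟨(i, j), rfl⟩)
    rw [f.dense_span] at this
    exact this trivial
  have h2 : ∀ u ψ, mulRight m k u ψ ∈ U := by
    intro u ψ
    have hψ : ψ ∈ antisym H m := hm ▸ trivial
    have : (Submodule.span ℂ (Set.range e)).topologicalClosure
        ≤ U.comap ((mulRight m k).flip ψ).toLinearMap := by
      refine Submodule.topologicalClosure_minimal _ ?_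
        (hUc.preimage ((mulRight m k).flip ψ).continuous)
      rw [Submodule.span_le]
      rintro _ ⟨i, rfl⟩
      exact h1 i ⟨ψ, hψ⟩
    rw [e.dense_span] at this
    exact this trivial
  have h3 : ∀ a, toHTensor (m + k) a ∈ U := by
    intro a
    refine algTensor_induction a (by simp) (fun x => ?_) (fun c a h => ?_) (fun a b ha hb => ?_)
    · have := h2 (pureTensor fun i => x (Fin.natAdd m i)) (pureTensor fun i => x (Fin.castAdd k i))
      rw [mulRight_pure, Fin.append_castAdd_natAdd] at this
      exact this
    · rw [map_smul]; exact U.smul_mem c h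
    · rw [map_add]; exact U.add_mem ha hb
  intro Ψ _
  exact (denseRange_toHTensor (m + k)).induction_on (p := fun Ψ => Ψ ∈ U) Ψ hUc h3

theorem tsum_enorm_adjoint_tensorRight {m k : ℕ} (Ψ : HTensor H (m + k)) :
    ∑' i, ‖(tensorRight m (onb (HTensor H k) i)).adjoint Ψ‖ₑ ^ 2
      = ∑' p : onbIndex (HTensor H k) × onbIndex (antisym H m),
        ‖⟪tensorRight m (onb (HTensor H k) p.1) (onb (antisym H m) p.2), Ψ⟫_ℂ‖ₑ ^ 2 := by
  rw [ENNReal.tsum_prod']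
  refine tsum_congr fun i => ?_
  rw [← tsum_enorm_inner_sq (onb (antisym H m))]
  simp only [ContinuousLinearMap.adjoint_inner_right]

/-- Only Bessel is available for general `m`, since antisymmetric first factors need not span; an
upper bound suffices. -/
theorem tsum_enorm_adjoint_tensorRight_le {m k : ℕ} (Ψ : HTensor H (m + k)) :
    ∑' i, ‖(tensorRight m (onb (HTensor H k) i)).adjoint Ψ‖ₑ ^ 2 ≤ ‖Ψ‖ₑ ^ 2 := by
  rw [tsum_enorm_adjoint_tensorRight]
  exact tsum_enorm_inner_sq_le
    (orthonormal_tensorRight (onb (HTensor H k)).orthonormal (onb (antisym H m)).orthonormal) Ψ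

theorem tsum_enorm_adjoint_tensorRight_eq {m k : ℕ} (hm : antisym H m = ⊤)
    (Ψ : HTensor H (m + k)) :
    ∑' i, ‖(tensorRight m (onb (HTensor H k) i)).adjoint Ψ‖ₑ ^ 2 = ‖Ψ‖ₑ ^ 2 := by
  have h := tsum_enorm_inner_sq (HilbertBasis.mk (orthonormal_tensorRight
    (onb (HTensor H k)).orthonormal (onb (antisym H m)).orthonormal)
    (dense_span_tensorRight _ _ hm)) Ψ
  rw [HilbertBasis.coe_mk] at h
  rw [tsum_enorm_adjoint_tensorRight, h]

theorem antisym_one : antisym H 1 = ⊤ := by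
  refine eq_top_iff.2 fun ψ _ π => ?_
  have hπ : π = 1 := Subsingleton.elim _ _
  subst hπ
  have : permOp (H := H) (1 : Equiv.Perm (Fin 1)) = ContinuousLinearMap.id ℂ _ :=
    htensor_ext fun a => by
      refine algTensor_induction a (by simp) (fun x => ?_) (fun c a h => ?_) (fun a b ha hb => ?_)
      · exact permOp_pure 1 x
      · simp only [map_smul, h]
      · simp only [map_add, ha, hb]
  simp [this]

/-! ### Partial traces and reduced densities of dyad sums. -/

theorem extendByZero_dyadSum {ι : Type*} {n : ℕ} {v : ι → antisym H n}
    (hv : ∑' i, ‖v i‖ₑ ^ 2 ≠ ∞) :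
    extendByZero (dyadSum v) = dyadSum fun i => (v i : HTensor H n) := by
  have h := adjoint_comp_dyadSum_comp (antisym H n).orthogonalProjectionOnto hv
  rw [Submodule.adjoint_orthogonalProjectionOnto] at h
  exact h

/-- The bound in the first component supplies the summability that merges the double sum of the
second into one dyad sum. -/
theorem partialTrace_dyadSum {ι : Type*} {m k : ℕ} {v : ι → antisym H (m + k)}
    (hv : ∑' s, ‖v s‖ₑ ^ 2 ≠ ∞) :
    (∑' i, ∑' s, ‖(tensorRight m (onb (HTensor H k) i)).adjoint (v s)‖ₑ ^ 2 ≤ ∑' s, ‖v s‖ₑ ^ 2) ∧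
    partialTrace m k (dyadSum v) = dyadSum fun p : (_ : onbIndex (HTensor H k)) × ι =>
      (tensorRight m (onb (HTensor H k) p.1)).adjoint (v p.2) := by
  have hle : ∑' i, ∑' s, ‖(tensorRight m (onb (HTensor H k) i)).adjoint (v s)‖ₑ ^ 2
      ≤ ∑' s, ‖v s‖ₑ ^ 2 := by
    rw [ENNReal.tsum_comm]
    exact ENNReal.tsum_le_tsum fun s => tsum_enorm_adjoint_tensorRight_le _
  refine ⟨hle, ?_⟩
  rw [← tsum_dyadSum (ne_top_of_le_ne_top hv hle), partialTrace]
  refine tsum_congr fun i => ?_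
  rw [extendByZero_dyadSum hv]
  exact adjoint_comp_dyadSum_comp (tensorRight m (onb (HTensor H k) i))
    (v := fun s => (v s : HTensor H (m + k))) hv

/-- The trace of the reduced density, with the traces over the discarded particles kept as sums. -/
theorem traceNorm_reducedDensity_dyadSum {ι : Type*} {w : ι → Fock H}
    (hw : ∑' s, ‖w s‖ₑ ^ 2 ≠ ∞) (m : ℕ)
    (hm : ∑' k, ((m + k).descFactorial m : ℝ≥0∞) * ∑' s, ‖w s (m + k)‖ₑ ^ 2 ≠ ∞) :
    traceNorm (reducedDensity m (dyadSum w)) =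
      ∑' k, ((m + k).descFactorial m : ℝ≥0∞) * ∑' s, ∑' i,
        ‖(tensorRight m (onb (HTensor H k) i)).adjoint (w s (m + k))‖ₑ ^ 2 := by
  -- As a nonnegative real, the coefficient can be absorbed into the vectors through its square
  -- root.
  have hc : ∀ k : ℕ, ((m + k)! : ℂ) / (k ! : ℂ) = (((m + k).descFactorial m : ℝ) : ℂ) := by
    intro k
    rw [div_eq_iff (by exact_mod_cast k.factorial_ne_zero)]
    have := Nat.factorial_mul_descFactorial (Nat.le_add_right m k)
    rw [Nat.add_sub_cancel_left] at this
    rw [← this]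
    push_cast
    ring
  have hR : reducedDensity m (dyadSum w) = ∑' k, dyadSum
      fun p : (_ : onbIndex (HTensor H k)) × ι =>
        ((√((m + k).descFactorial m : ℝ) : ℝ) : ℂ) •
          (tensorRight m (onb (HTensor H k) p.1)).adjoint (w p.2 (m + k)) := by
    refine tsum_congr fun k => ?_
    rw [block_dyadSum hw, (partialTrace_dyadSum (tsum_enorm_apply_sq_ne_top hw _)).2, hc,
      smul_dyadSum _ _ (by positivity)]
  have hval : ∀ k, ∑' p : (_ : onbIndex (HTensor H k)) × ι,
      ‖((√((m + k).descFactorial m : ℝ) : ℝ) : ℂ) •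
          (tensorRight m (onb (HTensor H k) p.1)).adjoint (w p.2 (m + k))‖ₑ ^ 2 =
      ((m + k).descFactorial m : ℝ≥0∞) * ∑' s, ∑' i,
        ‖(tensorRight m (onb (HTensor H k) i)).adjoint (w s (m + k))‖ₑ ^ 2 := by
    intro k
    simp only [enorm_sqrt_smul_sq _ (Nat.cast_nonneg (α := ℝ) _), ENNReal.ofReal_natCast]
    rw [ENNReal.tsum_mul_left, ENNReal.tsum_sigma']
    congr 1
    exact ENNReal.tsum_comm
  have hfin : ∑' k, ∑' p : (_ : onbIndex (HTensor H k)) × ι,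
      ‖((√((m + k).descFactorial m : ℝ) : ℝ) : ℂ) •
          (tensorRight m (onb (HTensor H k) p.1)).adjoint (w p.2 (m + k))‖ₑ ^ 2 ≠ ∞ := by
    simp only [hval]
    refine ne_top_of_le_ne_top hm (ENNReal.tsum_le_tsum fun k => ?_)
    gcongr with s
    exact tsum_enorm_adjoint_tensorRight_le _
  rw [hR, tsum_dyadSum hfin, traceNorm_dyadSum, ENNReal.tsum_sigma']
  · simp only [hval]
  · rwa [ENNReal.tsum_sigma']

end Slices

/-! ## Reduced densities of quasifree densities -/

section Quasifree

variable {H J : Type*} [NormedAddCommGroup H] [InnerProductSpace ℂ H]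
  (b : HilbertBasis J ℂ H) (ℙ : PMF (Finset J))

theorem norm_occupation_slater (s : Finset J) :
    ‖slater fun i => b (s.equivFin.symm i : J)‖ = 1 :=
  norm_slater (b.orthonormal.comp _ (Subtype.val_injective.comp s.equivFin.symm.injective))

variable [CompleteSpace H]

/-- The occupation number vectors weighted by the square roots of their probabilities. -/
def weightedVector (s : Finset J) : Fock H :=
  ((√(ℙ s).toReal : ℝ) : ℂ) • occupationVector b s

theorem weightedVector_eq_incl (s : Finset J) :
    weightedVector b ℙ s = incl H s.card
      (((√(ℙ s).toReal : ℝ) : ℂ) • slater fun i => b (s.equivFin.symm i : J)) := by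
  rw [weightedVector, occupationVector, map_smul]

theorem enorm_weightedVector_apply_sq (s : Finset J) (n : ℕ) :
    ‖weightedVector b ℙ s n‖ₑ ^ 2 = if s.card = n then ℙ s else 0 := by
  rw [weightedVector_eq_incl, enorm_incl_apply]
  split_ifs with h
  · rw [enorm_sqrt_smul_sq _ ENNReal.toReal_nonneg, ENNReal.ofReal_toReal (ℙ.apply_ne_top s),
      ← ofReal_norm, norm_occupation_slater]
    simp
  · simp

theorem enorm_weightedVector_sq (s : Finset J) : ‖weightedVector b ℙ s‖ₑ ^ 2 = ℙ s := by
  rw [weightedVector, enorm_sqrt_smul_sq _ ENNReal.toReal_nonneg,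
    ENNReal.ofReal_toReal (ℙ.apply_ne_top s), ← ofReal_norm, occupationVector, norm_incl,
    norm_occupation_slater]
  simp

theorem tsum_enorm_weightedVector_sq : ∑' s, ‖weightedVector b ℙ s‖ₑ ^ 2 = 1 := by
  simp only [enorm_weightedVector_sq, ℙ.tsum_coe]

/-- Since `Ψ(s)` is a unit vector, the projector onto its span is its dyad. -/
theorem quasifreeDensity_eq_dyadSum : quasifreeDensity b ℙ = dyadSum (weightedVector b ℙ) := by
  refine tsum_congr fun s => ?_
  rw [weightedVector, rankOne_sqrt_smul _ ENNReal.toReal_nonneg]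
  congr 1
  ext1 x
  rw [Submodule.starProjection_unit_singleton ℂ
    (by rw [occupationVector, norm_incl, norm_occupation_slater]), rankOne_apply]

/-- Both sides are the expectation of `c(N)`: the vector of `s` lies in sector `s.card` and has
squared norm `ℙ s`. -/
theorem tsum_mul_tsum_weightedVector (c : ℕ → ℝ≥0∞) :
    ∑' n, c n * ∑' s, ‖weightedVector b ℙ s n‖ₑ ^ 2 = ∑' s, ℙ s * c s.card := by
  simp only [enorm_weightedVector_apply_sq, ← ENNReal.tsum_mul_left]
  rw [ENNReal.tsum_comm]
  refine tsum_congr fun s => ?_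
  rw [tsum_eq_single s.card (fun n hn => by simp [hn.symm])]
  simp [mul_comm]

theorem tsum_descFactorial_mul_tsum_weightedVector (m : ℕ) :
    ∑' k, ((m + k).descFactorial m : ℝ≥0∞) * ∑' s, ‖weightedVector b ℙ s (m + k)‖ₑ ^ 2
      = ∑' s, ℙ s * (s.card.descFactorial m : ℝ≥0∞) := by
  rw [← tsum_mul_tsum_weightedVector b ℙ fun n => (n.descFactorial m : ℝ≥0∞)]
  -- Starting the sum at `n = m` loses nothing, as the falling factorial vanishes for `n < m`.
  refine (add_right_injective m).tsum_eq (f := fun n => (n.descFactorial m : ℝ≥0∞)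
    * ∑' s, ‖weightedVector b ℙ s n‖ₑ ^ 2) fun n hn => ?_
  have h : m ≤ n := by
    by_contra h
    exact hn (by simp [Nat.descFactorial_of_lt (not_le.1 h)])
  exact ⟨n - m, Nat.add_sub_cancel' h⟩

variable {ℙ}

theorem isDensityWithMoments_quasifreeDensity (hℙ : IndependentOccupations ℙ) :
    IsDensityWithMoments (quasifreeDensity b ℙ) := by
  have hw : ∑' s, ‖weightedVector b ℙ s‖ₑ ^ 2 ≠ ∞ := by
    rw [tsum_enorm_weightedVector_sq]; exact ENNReal.one_ne_top
  rw [quasifreeDensity_eq_dyadSum]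
  refine ⟨isPositive_dyadSum hw, ?_, fun n => ?_, fun m => ?_⟩
  · rw [posTrace_dyadSum hw, tsum_enorm_weightedVector_sq]
  · refine commute_dyadSum fun s => ?_
    rw [weightedVector_eq_incl]
    exact commute_rankOne_sectorProj _ _ _
  · have h : ∀ n, posTrace (block n (dyadSum (weightedVector b ℙ)))
        = ∑' s, ‖weightedVector b ℙ s n‖ₑ ^ 2 := fun n => by
      rw [block_dyadSum hw, posTrace_dyadSum (tsum_enorm_apply_sq_ne_top hw n)]
    simp only [h]
    rw [tsum_mul_tsum_weightedVector b ℙ fun n => (n : ℝ≥0∞) ^ m]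
    exact (tsum_mul_card_pow_ne_top hℙ m).lt_top

theorem traceNorm_reducedDensity_quasifreeDensity (hℙ : IndependentOccupations ℙ) (m : ℕ) :
    traceNorm (reducedDensity m (quasifreeDensity b ℙ)) =
      ∑' k, ((m + k).descFactorial m : ℝ≥0∞) * ∑' s, ∑' i,
        ‖(tensorRight m (onb (HTensor H k) i)).adjoint (weightedVector b ℙ s (m + k))‖ₑ ^ 2 := by
  rw [quasifreeDensity_eq_dyadSum]
  refine traceNorm_reducedDensity_dyadSum ?_ m ?_
  · rw [tsum_enorm_weightedVector_sq]; exact ENNReal.one_ne_top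
  · rw [tsum_descFactorial_mul_tsum_weightedVector]
    exact ne_top_of_le_ne_top (ENNReal.pow_ne_top (tsum_occupationProb_ne_top hℙ))
      (tsum_mul_descFactorial_le hℙ m)

theorem traceNorm_reducedDensity_quasifreeDensity_le (hℙ : IndependentOccupations ℙ) (m : ℕ) :
    traceNorm (reducedDensity m (quasifreeDensity b ℙ)) ≤ (∑' j, occupationProb ℙ j) ^ m := by
  refine le_trans ?_ (tsum_mul_descFactorial_le hℙ m)
  rw [traceNorm_reducedDensity_quasifreeDensity b hℙ,
    ← tsum_descFactorial_mul_tsum_weightedVector b]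
  refine ENNReal.tsum_le_tsum fun k => ?_
  gcongr with s
  exact tsum_enorm_adjoint_tensorRight_le _

/-- Equality is essential, as this quantity is the base of the power on the larger side; it holds
because `antisym H 1` is all of `H^{⊗1}`, so Parseval replaces Bessel. -/
theorem traceNorm_reducedDensity_one_quasifreeDensity (hℙ : IndependentOccupations ℙ) :
    traceNorm (reducedDensity 1 (quasifreeDensity b ℙ)) = ∑' j, occupationProb ℙ j := by
  rw [traceNorm_reducedDensity_quasifreeDensity b hℙ, ← tsum_mul_card]
  have h := tsum_descFactorial_mul_tsum_weightedVector b ℙ 1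
  simp only [Nat.descFactorial_one] at h ⊢
  rw [← h]
  refine tsum_congr fun k => ?_
  congr 1
  exact tsum_congr fun s => tsum_enorm_adjoint_tensorRight_eq antisym_one _

end Quasifree

end Fermion

end

theorem mainTheorem8 {H J : Type*} [NormedAddCommGroup H] [InnerProductSpace ℂ H] [CompleteSpace H]
    (b : HilbertBasis J ℂ H) (ℙ : PMF (Finset J)) (hℙ : Fermion.IndependentOccupations ℙ) :
    Fermion.IsDensityWithMoments (Fermion.quasifreeDensity b ℙ) ∧
    Fermion.traceNorm (Fermion.reducedDensity 1 (Fermion.quasifreeDensity b ℙ)) < ⊤ ∧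
    ∀ n : ℕ, Fermion.traceNorm (Fermion.reducedDensity n (Fermion.quasifreeDensity b ℙ)) ≤
      Fermion.traceNorm (Fermion.reducedDensity 1 (Fermion.quasifreeDensity b ℙ)) ^ n := by
  refine ⟨Fermion.isDensityWithMoments_quasifreeDensity b hℙ, ?_, fun n => ?_⟩
  · rw [Fermion.traceNorm_reducedDensity_one_quasifreeDensity b hℙ]
    exact (Fermion.tsum_occupationProb_ne_top hℙ).lt_top
  · rw [Fermion.traceNorm_reducedDensity_one_quasifreeDensity b hℙ]
    exact Fermion.traceNorm_reducedDensity_quasifreeDensity_le b hℙ n
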